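/- Let $\Gamma=(V,E)$ be a finite simple graph. An outer independent total double Roman dominating function (OITDRDF) on $\Gamma$ is a map $f:V\to\{0,1,2,3\}$ such that (i) every vertex $v$ with $f(v)=0$ has a neighbour labelled $3$ or two distinct neighbours labelled $2$; (ii) every vertex $v$ with $f(v)=1$ has a neighbour with label at least $2$; (iii) the set of vertices labelled $0$ induces an edgeless subgraph; (iv) the set of vertices with nonzero label induces a subgraph without isolated vertices. Let $\gamma^{oi}_{tdR}(\Gamma)$ be the minimum of $\sum_{v\in V}f(v)$ over all OITDRDFs $f$ on $\Gamma$. A leaf is a vertex of degree $1$, and a stem is a vertex adjacent to a leaf. The corona $\mathrm{Cor}(F)$ of a graph $F$ is obtained from $F$ by adding, for each vertex $y$ of $F$, a new vertex $y'$ and the edge $yy'$. **Theorem.** For every tree $M$ of order $p\ge 3$ with $s(M)$ stems, $$\gamma^{oi}_{tdR}(M)\le\frac{6p+3s(M)}{5}.$$ Moreover, equality holds for every tree $M$ of order $p\ge 3$ that is isomorphic to $\mathrm{Cor}(F)$ for some tree $F$. -/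

import Mathlib

universe u

namespace RomanDom

/-- A double Roman dominating function: a labelling by `0, 1, 2, 3` such that every vertex
labelled `0` has a neighbour labelled `3` or two distinct neighbours labelled `2`, and every
vertex labelled `1` has a neighbour with label at least `2`. -/
structure IsDRDF {V : Type u} (G : SimpleGraph V) (f : V → ℕ) : Prop where
  le_three : ∀ v, f v ≤ 3
  zero : ∀ v, f v = 0 →
    (∃ y, G.Adj v y ∧ f y = 3) ∨
      ∃ y z, y ≠ z ∧ G.Adj v y ∧ G.Adj v z ∧ f y = 2 ∧ f z = 2
  one : ∀ v, f v = 1 → ∃ y, G.Adj v y ∧ 2 ≤ f y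

/-- An outer independent total double Roman dominating function: a double Roman dominating
function for which the vertices labelled `0` induce an edgeless subgraph and the vertices with
nonzero label induce a subgraph without isolated vertices. -/
structure IsOITDRDF {V : Type u} (G : SimpleGraph V) (f : V → ℕ) : Prop
    extends IsDRDF G f where
  outerIndep : G.IsIndepSet {v | f v = 0}
  total : ∀ v : {v : V | f v ≠ 0}, ¬ (G.induce {v : V | f v ≠ 0}).IsIsolated v

/-- The minimum weight of an outer independent total double Roman dominating function.
(If there is none, that is, if the graph has an isolated vertex, the value is `0` by the
convention for `sInf` on `ℕ`; see `exists_isOITDRDF` for graphs without isolated vertices.) -/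
noncomputable def oitdrdNumber {V : Type u} [Fintype V] (G : SimpleGraph V) : ℕ :=
  sInf {w : ℕ | ∃ f : V → ℕ, IsOITDRDF G f ∧ ∑ v, f v = w}

/-- A leaf is a vertex of degree one. -/
def IsLeaf {V : Type u} (G : SimpleGraph V) (v : V) : Prop :=
  (G.neighborSet v).ncard = 1

/-- A stem is a vertex that is the neighbour of a leaf. -/
def IsStem {V : Type u} (G : SimpleGraph V) (v : V) : Prop :=
  ∃ w, G.Adj v w ∧ IsLeaf G w

/-- The number of stems. -/
noncomputable def numStems {V : Type u} (G : SimpleGraph V) : ℕ :=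
  {v : V | IsStem G v}.ncard

/-- The corona: a copy `inl` of `F` together with a new vertex `inr y` for every vertex `y` of
`F`, joined to `inl y` only. -/
def corona {W : Type u} (F : SimpleGraph W) : SimpleGraph (W ⊕ W) where
  Adj
    | .inl x, .inl y => F.Adj x y
    | .inl x, .inr y => x = y
    | .inr x, .inl y => x = y
    | .inr _, .inr _ => False
  symm := ⟨by
    rintro (x | x) (y | y) h
    · exact SimpleGraph.Adj.symm (G := F) h
    · exact Eq.symm h
    · exact Eq.symm h
    · exact h⟩
  loopless := ⟨by
    rintro (x | x) h
    · exact F.irrefl h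
    · exact h⟩

/-- Membership, up to isomorphism, in the family of coronas of trees. -/
def IsTreeCorona {V : Type u} (G : SimpleGraph V) : Prop :=
  ∃ (W : Type u) (F : SimpleGraph W), F.IsTree ∧ Nonempty (G ≃g corona F)

/-- In a graph without isolated vertices the constant labelling `2` is an outer independent total
double Roman dominating function, so the minimum defining `oitdrdNumber` is over a nonempty set. -/
theorem exists_isOITDRDF {V : Type u} (G : SimpleGraph V) (h : ∀ v, ∃ w, G.Adj v w) :
    ∃ f : V → ℕ, IsOITDRDF G f := by
  refine ⟨fun _ => 2, ⟨⟨fun _ => by norm_num, fun _ h0 => by norm_num at h0,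
    fun _ h0 => by norm_num at h0⟩, ?_, ?_⟩⟩
  · intro v hv
    simp at hv
  · rintro ⟨v, hv⟩ hiso
    obtain ⟨w, hw⟩ := h v
    exact hiso ⟨w, by simp⟩ hw

end RomanDom

namespace RomanDom

open SimpleGraph

/-! ### Parents, children and leaves in a rooted tree -/

section Tree

variable {V : Type u} {M : SimpleGraph V}

/-! The upper bound is an averaging argument. Root the tree at a stem `u` with a leaf `x` and label
each vertex by its level mod 5 and its type. All five shifts of the levels give valid labellings
(`isOITDRDF_levelLabel`). Over the shifts an ordinary vertex receives 6 in total, a leaf 4 and a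
stem 11, so with L leaves and s stems the weights add up to 6p + 5s - 2L plus a correction at `u`
and `x`. Since L ≥ s, this is at most 6p + 3s once the correction is absorbed: it is 0 if `x` is the
only leaf at `u`, and otherwise 2, paid for by L ≥ s + 1. In a corona the leaf-stem edges partition
the vertices and each carries weight at least 3, which matches the bound. -/

theorem IsLeaf.eq_of_adj {v a b : V} (hv : IsLeaf M v) (ha : M.Adj v a) (hb : M.Adj v b) :
    a = b := by
  obtain ⟨w, hw⟩ := Set.ncard_eq_one.mp hv
  have ha' : a ∈ M.neighborSet v := ha
  have hb' : b ∈ M.neighborSet v := hb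
  rw [hw] at ha' hb'
  exact ha'.trans hb'.symm

theorem IsLeaf.exists_adj {v : V} (hv : IsLeaf M v) : ∃ w, M.Adj v w := by
  obtain ⟨w, hw⟩ := Set.ncard_eq_one.mp hv
  exact ⟨w, by simpa using (hw ▸ Set.mem_singleton w : w ∈ M.neighborSet v)⟩

theorem isLeaf_of_forall_adj_eq {v w : V} (h : M.Adj v w) (hv : ∀ a, M.Adj v a → a = w) :
    IsLeaf M v := by
  refine Set.ncard_eq_one.mpr ⟨w, Set.ext fun a => ⟨fun ha => hv a ha, ?_⟩⟩
  rintro rfl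
  exact h

/-- In a connected graph on at least three vertices, a stem is not a leaf. -/
theorem not_isLeaf_of_isStem [Fintype V] (hM : M.Connected) (hp : 3 ≤ Fintype.card V) {v : V}
    (hv : IsStem M v) : ¬ IsLeaf M v := by
  classical
  obtain ⟨w, hvw, hw⟩ := hv
  intro hl
  have key : ∀ a, M.Reachable v a → a = v ∨ a = w := by
    rintro a ⟨p⟩
    suffices h : ∀ b c (q : M.Walk b c), (b = v ∨ b = w) → (c = v ∨ c = w) from
      h _ _ p (Or.inl rfl)
    intro b c q
    induction q with
    | nil => exact id
    | cons h _ ih =>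
      rintro (rfl | rfl)
      · exact ih (Or.inr (hl.eq_of_adj h hvw))
      · exact ih (Or.inl (hw.eq_of_adj h hvw.symm))
  have hcard : Fintype.card V ≤ ({v, w} : Finset V).card := by
    refine Finset.card_le_card fun a _ => ?_
    simpa using key a (hM v a)
  have := Finset.card_le_two (a := v) (b := w)
  omega

theorem exists_adj_dist_eq_add_one (hM : M.Connected) {u v : V} (h : v ≠ u) :
    ∃ w, M.Adj v w ∧ M.dist u v = M.dist u w + 1 := by
  obtain ⟨p, hp⟩ := hM.exists_walk_length_eq_dist v u
  cases p with
  | nil => exact absurd rfl h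
  | @cons _ w _ hvw q =>
    refine ⟨w, hvw, ?_⟩
    have h1 := dist_le q
    have h2 := hvw.diff_dist_adj (u := u)
    rw [Walk.length_cons, dist_comm] at hp
    rw [dist_comm] at h1
    omega

/-- Uniqueness of parents: geodesics through `a` and `b` both extend to paths from `u` to `v`, which
coincide in a tree. -/
theorem eq_of_dist_eq_add_one (hM : M.IsTree) {u v a b : V} (ha : M.Adj v a) (hb : M.Adj v b)
    (hda : M.dist u v = M.dist u a + 1) (hdb : M.dist u v = M.dist u b + 1) : a = b := by
  obtain ⟨p, hp⟩ := hM.connected.exists_walk_length_eq_dist u a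
  have hpath : (p.concat ha.symm).IsPath := by
    apply Walk.isPath_of_length_eq_dist
    rw [Walk.length_concat, hp, hda]
  obtain ⟨q, hq⟩ := hM.connected.exists_walk_length_eq_dist u b
  have hqath : (q.concat hb.symm).IsPath := by
    apply Walk.isPath_of_length_eq_dist
    rw [Walk.length_concat, hq, hdb]
  have h := (hM.existsUnique_path u v).unique hpath hqath
  have := congrArg Walk.penultimate h
  simpa using this

/-- In a rooted tree, a vertex which is neither the root nor a leaf has a child. -/
theorem exists_adj_dist_add_one_eq (hM : M.IsTree) {u v : V} (h : v ≠ u) (hv : ¬ IsLeaf M v) :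
    ∃ w, M.Adj v w ∧ M.dist u w = M.dist u v + 1 := by
  obtain ⟨a, ha, hda⟩ := exists_adj_dist_eq_add_one hM.connected h
  by_contra! hc
  refine hv (isLeaf_of_forall_adj_eq ha fun b hb => ?_)
  refine eq_of_dist_eq_add_one hM hb ha ?_ hda
  exact (hM.dist_eq_dist_add_one_of_adj u hb).resolve_right (hc b hb)

/-- The neighbour of a leaf other than the root is its parent. -/
theorem IsLeaf.dist_eq_add_one (hM : M.Connected) {u v w : V} (hv : IsLeaf M v) (h : v ≠ u)
    (hvw : M.Adj v w) : M.dist u v = M.dist u w + 1 := by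
  obtain ⟨a, ha, hda⟩ := exists_adj_dist_eq_add_one hM h
  rwa [hv.eq_of_adj hvw ha]

end Tree

/-! ### Labellings by level modulo five -/

/-- The sequence of period five with the given values. -/
def periodic (a b c d e n : ℕ) : ℕ :=
  if n % 5 = 0 then a else if n % 5 = 1 then b else if n % 5 = 2 then c
  else if n % 5 = 3 then d else e

theorem sum_periodic (a b c d e n : ℕ) :
    ∑ k ∈ Finset.range 5, periodic a b c d e (n + k) = a + b + c + d + e := by
  have h : n % 5 < 5 := Nat.mod_lt _ (by norm_num)
  simp only [Finset.sum_range_succ, Finset.sum_range_zero, periodic, Nat.add_mod n]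
  interval_cases n % 5 <;> simp <;> omega

section Labelling

variable {V : Type u} (M : SimpleGraph V)

open Classical in
/-- The label of a vertex `v` of a tree rooted at a stem `u` next to the leaf `x`, as a function
of the level of `v`. The numbers `i` and `j` are the labels of `x` at level one and of `u` at
level four. -/
noncomputable def levelLabel (u x : V) (i j : ℕ) (v : V) : ℕ → ℕ :=
  if v = x then periodic 1 i 1 1 2
  else if v = u then periodic 3 2 2 1 j
  else if IsLeaf M v then periodic 0 0 1 1 2
  else if IsStem M v then periodic 3 2 2 1 3
  else periodic 0 2 1 1 2

variable {M}

/-- The root has no parent to rely on, hence the exceptional labels. With `i = 0`, `u` needs a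
non-leaf child to avoid isolation; with `j = 2`, `u` cannot serve a leaf labelled `0`, so `x`, then
labelled `1`, must be its only leaf. -/
theorem isOITDRDF_levelLabel [Fintype V] (hM : M.IsTree) (hp : 3 ≤ Fintype.card V) {u x : V}
    (hux : M.Adj u x) (hx : IsLeaf M x) {i j : ℕ}
    (hi : i = 1 ∨ i = 0 ∧ ∃ w, M.Adj u w ∧ ¬ IsLeaf M w)
    (hj : j = 3 ∨ j = 2 ∧ ∀ w, M.Adj u w → IsLeaf M w → w = x) (k : ℕ) :
    IsOITDRDF M fun v => levelLabel M u x i j v (M.dist u v + k) := by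
  set f : V → ℕ := fun v => levelLabel M u x i j v (M.dist u v + k) with hf
  set l : V → ℕ := fun v => (M.dist u v + k) % 5 with hl
  have hstem : ∀ {a b}, M.Adj a b → IsLeaf M b → IsStem M a := fun h hb => ⟨_, h, hb⟩
  have hnl : ∀ {a}, IsStem M a → ¬ IsLeaf M a := not_isLeaf_of_isStem hM.connected hp
  have hu : ¬ IsLeaf M u := hnl (hstem hux hx)
  have hxu : x ≠ u := hux.ne'
  have l5 : ∀ v, l v < 5 := fun v => Nat.mod_lt _ (by norm_num)
  have hup : ∀ {a b}, M.dist u a = M.dist u b + 1 → l a = (l b + 1) % 5 := by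
    intro a b h
    simp only [hl, h]
    omega
  have hadj : ∀ {a b}, M.Adj a b → l a = (l b + 1) % 5 ∨ l b = (l a + 1) % 5 := fun h =>
    (hM.dist_eq_dist_add_one_of_adj u h).imp hup hup
  have fx : f x = if l x = 0 then 1 else if l x = 1 then i else if l x = 2 then 1
      else if l x = 3 then 1 else 2 := by
    simp [hf, levelLabel, periodic, hl]
  have fu : f u = if l u = 0 then 3 else if l u = 1 then 2 else if l u = 2 then 2
      else if l u = 3 then 1 else j := by
    simp only [hf, levelLabel, periodic, hl, if_neg hxu.symm, if_true]
  have fleaf : ∀ {v}, v ≠ x → IsLeaf M v → f v = if l v = 0 then 0 else if l v = 1 then 0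
      else if l v = 2 then 1 else if l v = 3 then 1 else 2 := by
    intro v h1 h2
    have h3 : v ≠ u := by rintro rfl; exact hu h2
    simp only [hf, levelLabel, periodic, hl, if_neg h1, if_neg h3, if_pos h2]
  have fstem : ∀ {v}, v ≠ u → IsStem M v → f v = if l v = 0 then 3 else if l v = 1 then 2
      else if l v = 2 then 2 else if l v = 3 then 1 else 3 := by
    intro v h1 h2
    have h3 : v ≠ x := by rintro rfl; exact hnl h2 hx
    simp only [hf, levelLabel, periodic, hl, if_neg h1, if_neg h3, if_neg (hnl h2),
      if_pos h2]
  have ford : ∀ {v}, ¬ IsLeaf M v → ¬ IsStem M v → f v = if l v = 0 then 0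
      else if l v = 1 then 2 else if l v = 2 then 1 else if l v = 3 then 1 else 2 := by
    intro v h1 h2
    have h3 : v ≠ x := by rintro rfl; exact h1 hx
    have h4 : v ≠ u := by rintro rfl; exact h2 (hstem hux hx)
    simp only [hf, levelLabel, periodic, hl, if_neg h3, if_neg h4, if_neg h1, if_neg h2]
  have hi1 : i ≤ 1 := by omega
  have hj2 : 2 ≤ j := by omega
  have hj3 : j ≤ 3 := by omega
  have lx : l x = (l u + 1) % 5 := hup (hx.dist_eq_add_one hM.connected hxu hux.symm)
  -- the labels of vertices that are not leaves
  have fnl : ∀ {v}, ¬ IsLeaf M v → f v ≤ 3 ∧ (f v = 0 → l v = 0 ∧ ¬ IsStem M v) ∧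
      (l v = 1 → f v = 2) ∧ (l v = 4 → 2 ≤ f v) ∧ (f v = 1 → l v = 2 ∧ ¬ IsStem M v ∨ l v = 3) := by
    intro v hv
    have := l5 v
    by_cases h1 : v = u
    · subst h1
      rw [fu]
      grind
    by_cases h2 : IsStem M v
    · rw [fstem h1 h2]
      grind
    · rw [ford hv h2]
      grind
  -- the labels of leaves
  have flf : ∀ {v}, IsLeaf M v → f v ≤ 3 ∧ (f v = 0 → l v = 0 ∧ v ≠ x ∨ l v = 1) ∧
      (l v = 2 ∨ l v = 3 → f v = 1) ∧ (l v = 4 → f v = 2) ∧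
      (f v = 1 → v = x ∧ l v ≤ 1 ∨ l v = 2 ∨ l v = 3) := by
    intro v hv
    have := l5 v
    by_cases h1 : v = x
    · subst h1
      rw [fx]
      grind
    · rw [fleaf h1 hv]
      grind
  -- the labels of stems, the root included
  have fstem' : ∀ {v}, IsStem M v → f v ≠ 0 ∧ (l v = 0 → f v = 3) ∧
      (l v = 1 ∨ l v = 2 → f v = 2) ∧
      (l v = 4 → v ≠ u → f v = 3) := by
    intro v hv
    have := l5 v
    by_cases h1 : v = u
    · subst h1
      rw [fu]
      grind
    · rw [fstem h1 hv]
      grind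
  have hleafadj : ∀ {v w}, IsLeaf M v → M.Adj v w → IsStem M w ∧ l v = (l w + 1) % 5 := by
    intro v w hv hvw
    exact ⟨hstem hvw.symm hv, hup (hv.dist_eq_add_one hM.connected
      (by rintro rfl; exact hu hv) hvw)⟩
  have hparent : ∀ {v}, v ≠ u → ∃ a, M.Adj v a ∧ l v = (l a + 1) % 5 ∧ ¬ IsLeaf M a := by
    intro v hv
    obtain ⟨a, ha, hd⟩ := exists_adj_dist_eq_add_one hM.connected hv
    refine ⟨a, ha, hup hd, fun hla => ?_⟩
    -- If `a` were a leaf, `v` would be its parent as well as its child, forcing 2 ≡ 0 mod 5.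
    have := (hleafadj hla ha.symm).2
    have := hup hd
    omega
  have hchild : ∀ {v}, v ≠ u → ¬ IsLeaf M v → ∃ b, M.Adj v b ∧ l b = (l v + 1) % 5 := by
    intro v hv hvl
    obtain ⟨b, hb, hd⟩ := exists_adj_dist_add_one_eq hM hv hvl
    exact ⟨b, hb, hup hd⟩
  refine ⟨⟨?_, ?_, ?_⟩, ?_, ?_⟩
  · intro v
    by_cases hv : IsLeaf M v
    · exact (flf hv).1
    · exact (fnl hv).1
  · intro v h0
    replace h0 : f v = 0 := h0
    by_cases hv : IsLeaf M v
    · left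
      obtain ⟨w, hvw⟩ := hv.exists_adj
      obtain ⟨hw, hlw⟩ := hleafadj hv hvw
      refine ⟨w, hvw, show f w = 3 from ?_⟩
      have := l5 w
      rcases (flf hv).2.1 h0 with ⟨hl0, hvx⟩ | hl1
      · have hw4 : l w = 4 := by omega
        by_cases hwu : w = u
        · subst hwu
          rcases hj with hj | ⟨-, hj⟩
          · rw [fu, hw4]
            simpa using hj
          · exact absurd (hj v hvw.symm hv) hvx
        · exact (fstem' hw).2.2.2 hw4 hwu
      · exact (fstem' hw).2.1 (by omega)
    · obtain ⟨hl0, hvs⟩ := (fnl hv).2.1 h0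
      have hvu : v ≠ u := by rintro rfl; exact hvs (hstem hux hx)
      obtain ⟨a, ha, hla, hna⟩ := hparent hvu
      obtain ⟨b, hb, hlb⟩ := hchild hvu hv
      have hnb : ¬ IsLeaf M b := fun h => hvs (hstem hb h)
      have := l5 a
      have h2 := (fnl hna).2.2.2.1 (by omega)
      have h3 := (fnl hna).1
      by_cases h4 : f a = 3
      · exact Or.inl ⟨a, ha, h4⟩
      · refine Or.inr ⟨a, b, ?_, ha, hb, show f a = 2 by omega, (fnl hnb).2.2.1 (by omega)⟩
        -- The parent is in class 4 and the child in class 1, so they differ.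
        rintro rfl
        omega
  · intro v h1
    replace h1 : f v = 1 := h1
    show ∃ y, M.Adj v y ∧ 2 ≤ f y
    by_cases hv : IsLeaf M v
    · obtain ⟨w, hvw⟩ := hv.exists_adj
      obtain ⟨hw, hlw⟩ := hleafadj hv hvw
      refine ⟨w, hvw, ?_⟩
      have := l5 w
      have h3 := fstem' hw
      have h4 := (fnl (hnl hw)).2.2.2.1
      rcases (flf hv).2.2.2.2 h1 with ⟨-, h⟩ | h | h <;> grind
    · rcases (fnl hv).2.2.2.2 h1 with ⟨hl2, hvs⟩ | hl3
      · have hvu : v ≠ u := by rintro rfl; exact hvs (hstem hux hx)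
        obtain ⟨a, ha, hla, hna⟩ := hparent hvu
        have := l5 a
        exact ⟨a, ha, ((fnl hna).2.2.1 (by omega)).ge⟩
      · by_cases hvu : v = u
        · subst hvu
          exact ⟨x, hux, ((flf hx).2.2.2.1 (by omega)).ge⟩
        · obtain ⟨b, hb, hlb⟩ := hchild hvu hv
          refine ⟨b, hb, ?_⟩
          by_cases hbl : IsLeaf M b
          · exact ((flf hbl).2.2.2.1 (by omega)).ge
          · exact (fnl hbl).2.2.2.1 (by omega)
  · intro a ha b hb _ hab
    replace ha : f a = 0 := ha
    replace hb : f b = 0 := hb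
    by_cases hal : IsLeaf M a
    · exact (fstem' (hleafadj hal hab).1).1 hb
    by_cases hbl : IsLeaf M b
    · exact (fstem' (hleafadj hbl hab.symm).1).1 ha
    have h1 := ((fnl hal).2.1 ha).1
    have h2 := ((fnl hbl).2.1 hb).1
    have := hadj hab
    omega
  · rintro ⟨v, hv0⟩
    suffices h : ∃ w, M.Adj v w ∧ f w ≠ 0 by
      obtain ⟨w, hvw, hw⟩ := h
      exact fun hiso => hiso ⟨w, hw⟩ hvw
    by_cases hv : IsLeaf M v
    · obtain ⟨w, hvw⟩ := hv.exists_adj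
      exact ⟨w, hvw, (fstem' (hleafadj hv hvw).1).1⟩
    have h5 := l5 v
    by_cases hvu : v = u
    · subst hvu
      by_cases hx0 : f x = 0
      · rcases hi with hi | ⟨-, w, hw, hwl⟩
        · rw [fx, hi] at hx0
          grind
        · have hlx : l x = 1 := by
            rw [fx] at hx0
            grind
          have hlw : l w = (l v + 1) % 5 := by
            refine hup ((hM.dist_eq_dist_add_one_of_adj v hw).resolve_left ?_)
            simp
          exact ⟨w, hw, by rw [(fnl hwl).2.2.1 (by omega)]; norm_num⟩
      · exact ⟨x, hux, hx0⟩
    by_cases hl1 : l v = 1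
    · obtain ⟨b, hb, hlb⟩ := hchild hvu hv
      refine ⟨b, hb, fun h0 => ?_⟩
      by_cases hbl : IsLeaf M b
      · have := (flf hbl).2.1 h0
        omega
      · have := (fnl hbl).2.1 h0
        omega
    · obtain ⟨a, ha, hla, hna⟩ := hparent hvu
      refine ⟨a, ha, fun h0 => ?_⟩
      have := ((fnl hna).2.1 h0).1
      omega

/-! ### Averaging and the upper bound -/

/-- The sum over five consecutive shifts of the labels of a vertex. -/
theorem sum_levelLabel (hs : ∀ v, IsStem M v → ¬ IsLeaf M v) {u x : V} (hux : M.Adj u x)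
    (hx : IsLeaf M x) (i j : ℕ) (v : V) (n : ℕ) [Decidable (v = x)] [Decidable (v = u)]
    [Decidable (IsLeaf M v)] [Decidable (IsStem M v)] :
    ∑ k ∈ Finset.range 5, levelLabel M u x i j v (n + k) + (if IsLeaf M v then 2 else 0)
      + (if v = u then 3 else 0) =
    6 + (if IsStem M v then 5 else 0) + (if v = x then i + 1 else 0)
      + (if v = u then j else 0) := by
  have hus : IsStem M u := ⟨x, hux, hx⟩
  have hul : ¬ IsLeaf M u := hs u hus
  have hxs : ¬ IsStem M x := fun h => hs x h hx
  unfold levelLabel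
  by_cases h1 : v = x
  · subst h1
    have := hux.ne'
    simp only [if_true, sum_periodic, if_pos hx, if_neg hxs, if_neg this]
    omega
  by_cases h2 : v = u
  · subst h2
    simp only [if_true, sum_periodic, if_pos hus, if_neg hul, if_neg h1]
    omega
  by_cases h3 : IsLeaf M v
  · have h4 : ¬ IsStem M v := fun h => hs v h h3
    simp only [sum_periodic, if_neg h1, if_neg h2, if_pos h3, if_neg h4]
  by_cases h4 : IsStem M v
  · simp only [sum_periodic, if_neg h1, if_neg h2, if_neg h3, if_pos h4]
  · simp only [sum_periodic, if_neg h1, if_neg h2, if_neg h3, if_neg h4]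

theorem oitdrdNumber_le [Fintype V] {f : V → ℕ} (hf : IsOITDRDF M f) :
    oitdrdNumber M ≤ ∑ v, f v :=
  Nat.sInf_le ⟨f, hf, rfl⟩

theorem five_mul_oitdrdNumber_add_le [Fintype V] (hM : M.IsTree) (hp : 3 ≤ Fintype.card V)
    {u x : V} (hux : M.Adj u x) (hx : IsLeaf M x) {i j : ℕ}
    (hi : i = 1 ∨ i = 0 ∧ ∃ w, M.Adj u w ∧ ¬ IsLeaf M w)
    (hj : j = 3 ∨ j = 2 ∧ ∀ w, M.Adj u w → IsLeaf M w → w = x) :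
    5 * oitdrdNumber M + 2 * {v : V | IsLeaf M v}.ncard + 3 ≤
      6 * Fintype.card V + 5 * numStems M + (i + 1) + j := by
  classical
  have h : 5 * oitdrdNumber M ≤ ∑ k ∈ Finset.range 5,
      ∑ v, levelLabel M u x i j v (M.dist u v + k) := by
    have := Finset.card_nsmul_le_sum (Finset.range 5)
      (fun k => ∑ v, levelLabel M u x i j v (M.dist u v + k)) (oitdrdNumber M)
      fun k _ => oitdrdNumber_le (isOITDRDF_levelLabel hM hp hux hx hi hj k)
    simpa using this
  rw [Finset.sum_comm] at h
  have hsum := Finset.sum_congr (rfl : (Finset.univ : Finset V) = Finset.univ) fun v _ =>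
    sum_levelLabel (fun _ => not_isLeaf_of_isStem hM.connected hp) hux hx i j v (M.dist u v)
  simp only [Finset.sum_add_distrib, Finset.sum_ite_eq', Finset.mem_univ, if_true,
    Finset.sum_const, Finset.card_univ, smul_eq_mul, ← Finset.sum_filter] at hsum
  have hcard : ∀ P : V → Prop, {v | P v}.ncard = (Finset.univ.filter fun v => P v).card :=
      fun P => by
      rw [← Set.ncard_coe_finset]
      simp
  rw [numStems, hcard, hcard]
  omega

/-- Choosing for each stem a leaf in `s` is injective, as a leaf has only one neighbour. -/
theorem numStems_le_ncard_of_forall [Finite V] {s : Set V} (hs : ∀ v ∈ s, IsLeaf M v)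
    (h : ∀ v, IsStem M v → ∃ w ∈ s, M.Adj v w) : numStems M ≤ s.ncard := by
  classical
  choose g hg using fun v : {v // IsStem M v} => h v v.2
  refine Set.ncard_le_ncard_of_injOn (fun v => if hv : IsStem M v then g ⟨v, hv⟩ else v) ?_ ?_
    s.toFinite
  · intro v hv
    have hv : IsStem M v := hv
    simpa [hv] using (hg ⟨v, hv⟩).1
  · intro a ha b hb hab
    have ha : IsStem M a := ha
    have hb : IsStem M b := hb
    simp only [dif_pos ha, dif_pos hb] at hab
    exact (hs _ (hg ⟨a, ha⟩).1).eq_of_adj (hg ⟨a, ha⟩).2.symm (hab ▸ (hg ⟨b, hb⟩).2.symm)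

theorem five_mul_oitdrdNumber_le [Fintype V] (hM : M.IsTree) (hp : 3 ≤ Fintype.card V) :
    5 * oitdrdNumber M ≤ 6 * Fintype.card V + 3 * numStems M := by
  classical
  have : Nontrivial V := Fintype.one_lt_card_iff_nontrivial.mp (by omega)
  obtain ⟨x, hx⟩ := hM.exists_vert_degree_one_of_nontrivial
  have hx : IsLeaf M x := by
    rwa [IsLeaf, Set.ncard_eq_toFinset_card']
  obtain ⟨u, hxu⟩ := hx.exists_adj
  have hul := not_isLeaf_of_isStem hM.connected hp ⟨x, hxu.symm, hx⟩
  by_cases h : ∃ y, M.Adj u y ∧ IsLeaf M y ∧ y ≠ x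
  · obtain ⟨y, huy, hy, hyx⟩ := h
    -- Here `i = 1`, `j = 3` cost 2 extra; every stem still has a leaf other than `x`, which
    -- recovers it.
    have h1 := five_mul_oitdrdNumber_add_le hM hp hxu.symm hx (Or.inl rfl) (Or.inl rfl)
    have h2 : numStems M ≤ ({v : V | IsLeaf M v} \ {x}).ncard := by
      refine numStems_le_ncard_of_forall (fun v hv => hv.1) ?_
      rintro v ⟨w, hvw, hw⟩
      by_cases hwx : w = x
      · obtain rfl : v = u := hx.eq_of_adj (hwx ▸ hvw.symm) hxu
        exact ⟨y, ⟨hy, hyx⟩, huy⟩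
      · exact ⟨w, ⟨hw, hwx⟩, hvw⟩
    have h3 := Set.ncard_sdiff_singleton_add_one (s := {v : V | IsLeaf M v}) hx
    omega
  · push Not at h
    have hw : ∃ w, M.Adj u w ∧ ¬ IsLeaf M w := by
      by_contra! hc
      exact hul (isLeaf_of_forall_adj_eq hxu.symm fun a ha => h a ha (hc a ha))
    have h1 := five_mul_oitdrdNumber_add_le hM hp hxu.symm hx (Or.inr ⟨rfl, hw⟩)
      (Or.inr ⟨rfl, h⟩)
    have h2 : numStems M ≤ {v : V | IsLeaf M v}.ncard := by
      refine numStems_le_ncard_of_forall (fun v hv => hv) ?_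
      rintro v ⟨w, hvw, hw⟩
      exact ⟨w, hw, hvw⟩
    omega

end Labelling

/-! ### The lower bound for coronas -/

section Corona

variable {V : Type u} {M : SimpleGraph V}

theorem IsOITDRDF.exists_adj_ne_zero {f : V → ℕ} (hf : IsOITDRDF M f) {v : V} (hv : f v ≠ 0) :
    ∃ w, M.Adj v w ∧ f w ≠ 0 := by
  by_contra! hc
  exact hf.total ⟨v, hv⟩ fun w hw => w.2 (hc w hw)

/-- A leaf and its stem have total label at least three. -/
theorem IsOITDRDF.three_le_add {f : V → ℕ} (hf : IsOITDRDF M f) {v w : V} (hv : IsLeaf M v)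
    (hvw : M.Adj v w) : 3 ≤ f w + f v := by
  by_cases h0 : f v = 0
  · rcases hf.zero v h0 with ⟨y, hy, h3⟩ | ⟨y, z, hyz, hy, hz, -, -⟩
    · rw [hv.eq_of_adj hvw hy]
      omega
    · exact absurd (hv.eq_of_adj hy hz) hyz
  by_cases h1 : f v = 1
  · obtain ⟨y, hy, h2⟩ := hf.one v h1
    rw [hv.eq_of_adj hvw hy]
    omega
  · obtain ⟨y, hy, h2⟩ := hf.exists_adj_ne_zero h0
    rw [hv.eq_of_adj hvw hy]
    omega

theorem three_mul_numStems_le_of_corona [Fintype V] (hM : M.IsTree) (hp : 3 ≤ Fintype.card V)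
    (hc : IsTreeCorona M) : 6 * Fintype.card V + 3 * numStems M ≤ 5 * oitdrdNumber M := by
  classical
  obtain ⟨W, F, -, ⟨e⟩⟩ := hc
  have : Finite (W ⊕ W) := Finite.of_equiv V e.toEquiv
  have : Finite W := Finite.sum_left W
  have := Fintype.ofFinite W
  have hcard : Fintype.card V = 2 * Fintype.card W := by
    rw [Fintype.card_congr e.toEquiv, Fintype.card_sum, two_mul]
  have hadj : ∀ y, M.Adj (e.symm (.inr y)) (e.symm (.inl y)) := fun y =>
    e.symm.map_adj_iff.mpr (show (corona F).Adj (.inr y) (.inl y) from rfl)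
  have hleaf : ∀ y, IsLeaf M (e.symm (.inr y)) := by
    refine fun y => isLeaf_of_forall_adj_eq (hadj y) fun a ha => ?_
    have h : (corona F).Adj (.inr y) (e a) := by
      simpa using e.map_adj_iff.mpr ha
    obtain ⟨z, rfl⟩ := e.symm.surjective a
    rw [e.apply_symm_apply] at h
    rcases z with z | z
    · obtain rfl : y = z := h
      rfl
    · exact False.elim h
  have hstems : numStems M ≤ Fintype.card W := by
    rw [← Nat.card_eq_fintype_card, ← Set.ncard_univ,
      ← Set.ncard_image_of_injective Set.univ (f := fun y => e.symm (Sum.inl y))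
        (e.symm.injective.comp Sum.inl_injective)]
    refine Set.ncard_le_ncard (fun v hv => ?_) (Set.toFinite _)
    have hvl := not_isLeaf_of_isStem hM.connected hp hv
    obtain ⟨z | z, rfl⟩ := e.symm.surjective v
    · exact ⟨z, trivial, rfl⟩
    · exact absurd (hleaf z) hvl
  -- Nonemptiness makes the infimum attained, excluding the default value `0`.
  have hne : {w : ℕ | ∃ f : V → ℕ, IsOITDRDF M f ∧ ∑ v, f v = w}.Nonempty := by
    have : Nontrivial V := Fintype.one_lt_card_iff_nontrivial.mp (by omega)
    obtain ⟨f, hf⟩ := exists_isOITDRDF M fun v =>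
      exists_adj_iff_not_isIsolated.mpr (hM.connected.preconnected.not_isIsolated v)
    exact ⟨_, f, hf, rfl⟩
  obtain ⟨f, hf, hw⟩ := Nat.sInf_mem hne
  have hsum : 3 * Fintype.card W ≤ oitdrdNumber M := by
    rw [oitdrdNumber, ← hw, ← e.symm.toEquiv.sum_comp, Fintype.sum_sum_type,
      ← Finset.sum_add_distrib]
    have := Finset.card_nsmul_le_sum Finset.univ
      (fun y => f (e.symm (.inl y)) + f (e.symm (.inr y))) 3
      fun y _ => hf.three_le_add (hleaf y) (hadj y)
    simpa [mul_comm] using this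
  omega

end Corona

end RomanDom

theorem mainTheorem6 {V : Type u} [Fintype V] (M : SimpleGraph V) (hM : M.IsTree)
    (hp : 3 ≤ Fintype.card V) :
    (RomanDom.oitdrdNumber M : ℝ) ≤
        (6 * (Fintype.card V : ℝ) + 3 * (RomanDom.numStems M : ℝ)) / 5 ∧
      (RomanDom.IsTreeCorona M →
        (RomanDom.oitdrdNumber M : ℝ) =
          (6 * (Fintype.card V : ℝ) + 3 * (RomanDom.numStems M : ℝ)) / 5) := by
  have h1 : (5 * RomanDom.oitdrdNumber M : ℝ) ≤
      6 * Fintype.card V + 3 * RomanDom.numStems M :=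
    mod_cast RomanDom.five_mul_oitdrdNumber_le hM hp
  refine ⟨by linarith, fun hc => ?_⟩
  have h2 : (6 * Fintype.card V + 3 * RomanDom.numStems M : ℝ) ≤
      5 * RomanDom.oitdrdNumber M :=
    mod_cast RomanDom.three_mul_numStems_le_of_corona hM hp hc
  linarith
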